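/- A lattice in $\mathbb R^d$ (that is, a discrete subgroup spanning $\mathbb R^d$) is called well-rounded if its shortest nonzero vectors span $\mathbb R^d$ and unimodular if its covolume equals $1$. The covering radius of a lattice $\Lambda\subset\mathbb R^d$ is the least $r$ such that $\mathbb R^d=\Lambda+B_r$, where $B_r$ is the closed Euclidean ball of radius $r$ centred at the origin. For $d\ge 1$ let $N_d$ be the greatest value of the covering radius over all well-rounded unimodular lattices in $\mathbb R^d$ (this greatest value exists). **Theorem.** There is a constant $c>0$ such that $$N_d > c\,\frac{d}{\sqrt{\log d}}\qquad\text{for all } d\ge 2 .$$ Moreover, for all $d\ge 30$, $$N_d>\frac{\sqrt d}{2}.$$ Consequently, for every $d\ge 30$ the lattice $\mathbb Z^d$, which is well-rounded and unimodular and has covering radius $\sqrt d/2$, does not realize the largest covering radius among well-rounded unimodular lattices in $\mathbb R^d$, and Woods's conjecture that $N_d=\sqrt d/2$ for all $d\ge 1$ is false. -/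

import Mathlib

open scoped Pointwise

/-- `v` is a shortest nonzero vector of `L`. -/
def IsShortestVector {d : ℕ} (L : Submodule ℤ (EuclideanSpace ℝ (Fin d)))
    (v : EuclideanSpace ℝ (Fin d)) : Prop :=
  v ∈ L ∧ v ≠ 0 ∧ ∀ w ∈ L, w ≠ 0 → ‖v‖ ≤ ‖w‖

/-- The shortest nonzero vectors of `L` span `ℝ^d`. -/
def IsWellRounded {d : ℕ} (L : Submodule ℤ (EuclideanSpace ℝ (Fin d))) : Prop :=
  Submodule.span ℝ {v | IsShortestVector L v} = ⊤

/-- The covering radius: the least `r` with `ℝ^d = L + B_r`, where `B_r` is the closed Euclidean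
ball of radius `r` about the origin (empty for negative `r`). -/
noncomputable def coveringRadius {d : ℕ} (L : Submodule ℤ (EuclideanSpace ℝ (Fin d))) : ℝ :=
  sInf {r : ℝ | (L : Set (EuclideanSpace ℝ (Fin d))) + Metric.closedBall 0 r = Set.univ}

/-- `L` is a (full-rank) lattice in `ℝ^d` of covolume one that is well-rounded. -/
structure IsWellRoundedUnimodular {d : ℕ} (L : Submodule ℤ (EuclideanSpace ℝ (Fin d))) :
    Prop where
  discrete : DiscreteTopology L
  isZLattice : IsZLattice ℝ L
  covolume_eq_one : ZLattice.covolume L = 1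
  wellRounded : IsWellRounded L

/-- The set of covering radii of the well-rounded unimodular lattices in `ℝ^d`. -/
def woodsRadii (d : ℕ) : Set ℝ :=
  {r | ∃ L : Submodule ℤ (EuclideanSpace ℝ (Fin d)),
    IsWellRoundedUnimodular L ∧ coveringRadius L = r}

/-- The number `N_d`: the greatest covering radius of a well-rounded unimodular lattice in
`ℝ^d`. -/
noncomputable def woodsN (d : ℕ) : ℝ := sSup (woodsRadii d)

/-- The integer lattice `ℤ^d` in `ℝ^d`. -/
noncomputable def intLattice (d : ℕ) : Submodule ℤ (EuclideanSpace ℝ (Fin d)) :=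
  Submodule.span ℤ (Set.range (EuclideanSpace.basisFun (Fin d) ℝ))

/-- Woods's conjecture: `N_d = √d / 2` in every dimension. -/
def WoodsConjecture : Prop := ∀ d : ℕ, 1 ≤ d → woodsN d = √(d : ℝ) / 2

/-! The lower bounds come from Construction A with some coordinates sacrificed. For a code `C` in
`(ZMod q)^d`, the integer vectors reducing into `C` contain every `q eᵢ`. If no nonzero one is
shorter than `q`, the `q eᵢ` are shortest vectors and the lattice is well-rounded. Scaling to
covolume one divides lengths by `index^(1/d)`, so a deep hole is wanted at the price of a moderate
index (`index_rpow_mul_le_woodsN`).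

For `√d / 2`, take `q = 2` and the words `(a, a, 0)`, `a` of even weight and length about `d/4`. The
index is about `2^(3d/4)`, the point `(1, 0, 1)` is at distance about `√(3d/4)` from the lattice,
and `2^(-3/4) √(3/4) ≈ 0.515 > 1/2`.

For `d / √log d`, take a prime `q` of order `√d` and a code vanishing on `m ≈ d / log d`
coordinates. A maximal such code without short vectors has index at most `q^(m+1)` times the number
of short vectors (`exists_dense_code`). Both factors are exponential in `d`, so scaling costs only a
constant, while `(0, q/2)` is at distance at least `q √m / 2` from the lattice.

That `N_d` is attained is a compactness argument: every competitor is `g L₀` with `L₀ ⊇ ℤ^d` from a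
finite list and `g` in a compact set (`isCompact_woodsRadii`). -/

/-! ### Covering radius: upper and lower bounds. -/

section CoveringRadius

variable {d : ℕ}

/-- The radii `r` with `ℝ^d = L + B_r`. -/
def coveringSet (L : Submodule ℤ (EuclideanSpace ℝ (Fin d))) : Set ℝ :=
  {r : ℝ | (L : Set (EuclideanSpace ℝ (Fin d))) + Metric.closedBall 0 r = Set.univ}

theorem mem_coveringSet_iff {L : Submodule ℤ (EuclideanSpace ℝ (Fin d))} {r : ℝ} :
    r ∈ coveringSet L ↔ ∀ x, ∃ w ∈ L, ‖x - w‖ ≤ r := by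
  simp only [coveringSet, Set.mem_ofPred_eq, Set.eq_univ_iff_forall, Set.mem_add]
  refine forall_congr' fun x => ⟨?_, ?_⟩
  · rintro ⟨w, hw, y, hy, rfl⟩
    exact ⟨w, hw, by simpa using hy⟩
  · rintro ⟨w, hw, h⟩
    exact ⟨w, hw, x - w, by simpa using h, by simp⟩

theorem nonneg_of_mem_coveringSet {L : Submodule ℤ (EuclideanSpace ℝ (Fin d))} {r : ℝ}
    (hr : r ∈ coveringSet L) : 0 ≤ r := by
  obtain ⟨w, -, hw⟩ := mem_coveringSet_iff.1 hr 0
  exact (norm_nonneg _).trans hw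

theorem bddBelow_coveringSet (L : Submodule ℤ (EuclideanSpace ℝ (Fin d))) :
    BddBelow (coveringSet L) := ⟨0, fun _ hr => nonneg_of_mem_coveringSet hr⟩

theorem coveringRadius_nonneg (L : Submodule ℤ (EuclideanSpace ℝ (Fin d))) :
    0 ≤ coveringRadius L := Real.sInf_nonneg fun _ hr => nonneg_of_mem_coveringSet hr

theorem coveringRadius_le {L : Submodule ℤ (EuclideanSpace ℝ (Fin d))} {r : ℝ}
    (h : ∀ x, ∃ w ∈ L, ‖x - w‖ ≤ r) : coveringRadius L ≤ r :=
  csInf_le (bddBelow_coveringSet L) (mem_coveringSet_iff.2 h)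

/-- Needed for lower bounds, because `sInf ∅ = 0`. Subtracting the integer part in a basis leaves a
remainder bounded by the sum of the basis norms. -/
theorem coveringSet_nonempty (L : Submodule ℤ (EuclideanSpace ℝ (Fin d))) [DiscreteTopology L]
    [IsZLattice ℝ L] : (coveringSet L).Nonempty := by
  let b := Module.Free.chooseBasis ℤ L
  let B := b.ofZLatticeBasis ℝ L
  refine ⟨∑ i, ‖B i‖, mem_coveringSet_iff.2 fun x => ⟨ZSpan.floor B x, ?_, ?_⟩⟩
  · have h := (ZSpan.floor B x).2
    exact (b.ofZLatticeBasis_span ℝ L).le h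
  · exact ZSpan.norm_fract_le B x

theorem le_coveringRadius {L : Submodule ℤ (EuclideanSpace ℝ (Fin d))} [DiscreteTopology L]
    [IsZLattice ℝ L] {r : ℝ} (p : EuclideanSpace ℝ (Fin d)) (h : ∀ w ∈ L, r ≤ ‖p - w‖) :
    r ≤ coveringRadius L := by
  refine le_csInf (coveringSet_nonempty L) fun s hs => ?_
  obtain ⟨w, hw, hws⟩ := mem_coveringSet_iff.1 hs p
  exact (h w hw).trans hws

end CoveringRadius

/-! ### Linear images of lattices. -/

section LinearImage

variable {d : ℕ}

/-- The image of `L` under the linear map `g`. -/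
def latticeMap (g : EuclideanSpace ℝ (Fin d) →L[ℝ] EuclideanSpace ℝ (Fin d))
    (L : Submodule ℤ (EuclideanSpace ℝ (Fin d))) : Submodule ℤ (EuclideanSpace ℝ (Fin d)) :=
  L.map (g.toLinearMap.restrictScalars ℤ)

theorem mem_latticeMap {g : EuclideanSpace ℝ (Fin d) →L[ℝ] EuclideanSpace ℝ (Fin d)}
    {L : Submodule ℤ (EuclideanSpace ℝ (Fin d))} {x : EuclideanSpace ℝ (Fin d)} :
    x ∈ latticeMap g L ↔ ∃ w ∈ L, g w = x := Iff.rfl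

theorem latticeMap_eq_comap (e : EuclideanSpace ℝ (Fin d) ≃L[ℝ] EuclideanSpace ℝ (Fin d))
    (L : Submodule ℤ (EuclideanSpace ℝ (Fin d))) :
    latticeMap e L = ZLattice.comap ℝ L e.symm.toLinearMap := by
  ext x
  rw [mem_latticeMap]
  change _ ↔ e.symm x ∈ L
  refine ⟨?_, fun h => ⟨_, h, by simp⟩⟩
  rintro ⟨w, hw, rfl⟩
  simpa using hw

/-- A linear endomorphism of nonzero determinant as a linear automorphism. -/
noncomputable def equivOfDetNeZero (g : EuclideanSpace ℝ (Fin d) →L[ℝ] EuclideanSpace ℝ (Fin d))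
    (hg : g.det ≠ 0) : EuclideanSpace ℝ (Fin d) ≃L[ℝ] EuclideanSpace ℝ (Fin d) :=
  g.toContinuousLinearEquivOfDetNeZero hg

theorem coe_equivOfDetNeZero {g : EuclideanSpace ℝ (Fin d) →L[ℝ] EuclideanSpace ℝ (Fin d)}
    (hg : g.det ≠ 0) : (equivOfDetNeZero g hg : _ →L[ℝ] _) = g :=
  g.coe_toContinuousLinearEquivOfDetNeZero hg

theorem discreteTopology_latticeMap {g : EuclideanSpace ℝ (Fin d) →L[ℝ] EuclideanSpace ℝ (Fin d)}
    (hg : g.det ≠ 0) (L : Submodule ℤ (EuclideanSpace ℝ (Fin d))) [DiscreteTopology L] :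
    DiscreteTopology (latticeMap g L) := by
  rw [← coe_equivOfDetNeZero hg, latticeMap_eq_comap]
  infer_instance

theorem isZLattice_latticeMap {g : EuclideanSpace ℝ (Fin d) →L[ℝ] EuclideanSpace ℝ (Fin d)}
    (hg : g.det ≠ 0) (L : Submodule ℤ (EuclideanSpace ℝ (Fin d))) [DiscreteTopology L]
    [IsZLattice ℝ L] :
    haveI := discreteTopology_latticeMap hg L
    IsZLattice ℝ (latticeMap g L) := by
  have := discreteTopology_latticeMap hg L
  set e := equivOfDetNeZero g hg
  have hmap : latticeMap g L = ZLattice.comap ℝ L e.symm.toLinearMap := by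
    rw [← coe_equivOfDetNeZero hg, latticeMap_eq_comap]
  refine ⟨?_⟩
  rw [hmap]
  exact IsZLattice.span_top

theorem covolume_latticeMap {g : EuclideanSpace ℝ (Fin d) →L[ℝ] EuclideanSpace ℝ (Fin d)}
    (hg : g.det ≠ 0) (L : Submodule ℤ (EuclideanSpace ℝ (Fin d))) [DiscreteTopology L]
    [IsZLattice ℝ L] : ZLattice.covolume (latticeMap g L) = |g.det| * ZLattice.covolume L := by
  classical
  have : DiscreteTopology (latticeMap g L) := discreteTopology_latticeMap hg L
  have : IsZLattice ℝ (latticeMap g L) := isZLattice_latticeMap hg L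
  set e := equivOfDetNeZero g hg with he
  have hge : (e : _ →L[ℝ] _) = g := coe_equivOfDetNeZero hg
  let b := Module.Free.chooseBasis ℤ L
  let b₀ := b.ofZLatticeBasis ℝ L
  have hmap : ZLattice.comap ℝ L e.symm.toLinearMap = latticeMap g L := by
    rw [← hge, latticeMap_eq_comap]
  -- Both covolumes are measured against the same real basis `b₀`, so their ratio is the determinant
  -- of `g`.
  let c := b.ofZLatticeComap ℝ L e.symm.toLinearEquiv
  have h1 := ZLattice.covolume_eq_det_mul_measureReal
    (ZLattice.comap ℝ L e.symm.toLinearMap) MeasureTheory.volume c b₀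
  have h2 := ZLattice.covolume_eq_det_mul_measureReal L MeasureTheory.volume b b₀
  rw [← hmap, h1, h2, ← mul_assoc, ← abs_mul]
  congr 2
  have : ((↑) ∘ c : _ → EuclideanSpace ℝ (Fin d)) = (g.toLinearMap) ∘ ((↑) ∘ b) := by
    ext1 i
    simp only [Function.comp_apply, c]
    rw [← hge]
    rfl
  rw [this, Module.Basis.det_comp]

/-- `k` carries `h L` onto `g L` and stretches distances by at most `‖k‖`, hence carries coverings
to coverings. -/
theorem coveringRadius_latticeMap_le
    {g h : EuclideanSpace ℝ (Fin d) →L[ℝ] EuclideanSpace ℝ (Fin d)}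
    (k : EuclideanSpace ℝ (Fin d) →L[ℝ] EuclideanSpace ℝ (Fin d))
    (hk : k ∘L h = g) (hg : g.det ≠ 0) (hh : h.det ≠ 0)
    (L : Submodule ℤ (EuclideanSpace ℝ (Fin d))) [DiscreteTopology L] [IsZLattice ℝ L] :
    coveringRadius (latticeMap g L) ≤ ‖k‖ * coveringRadius (latticeMap h L) := by
  have : DiscreteTopology (latticeMap h L) := discreteTopology_latticeMap hh L
  have : IsZLattice ℝ (latticeMap h L) := isZLattice_latticeMap hh L
  have key : ∀ r ∈ coveringSet (latticeMap h L), coveringRadius (latticeMap g L) ≤ ‖k‖ * r := by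
    intro r hr
    refine coveringRadius_le fun x => ?_
    have hx : k (h ((equivOfDetNeZero g hg).symm x)) = x := by
      rw [← ContinuousLinearMap.comp_apply, hk]
      nth_rewrite 1 [← coe_equivOfDetNeZero hg]
      simp
    obtain ⟨w, ⟨u, hu, rfl⟩, hw⟩ :=
      mem_coveringSet_iff.1 hr (h ((equivOfDetNeZero g hg).symm x))
    refine ⟨g u, ⟨u, hu, rfl⟩, ?_⟩
    have : x - g u = k (h ((equivOfDetNeZero g hg).symm x) - h u) := by
      rw [map_sub, hx, ← ContinuousLinearMap.comp_apply k h u, hk]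
    rw [this]
    exact (k.le_opNorm _).trans (mul_le_mul_of_nonneg_left hw (norm_nonneg k))
  have hne := coveringSet_nonempty (latticeMap h L)
  change _ ≤ ‖k‖ * sInf (coveringSet (latticeMap h L))
  rw [← smul_eq_mul, ← Real.sInf_smul_of_nonneg (norm_nonneg k)]
  refine le_csInf hne.smul_set ?_
  rintro _ ⟨r, hr, rfl⟩
  exact key r hr

/-- Comparing `f L` and `g L` in both directions squeezes the radius of `f L` between multiples of
that of `g L`. The factors tend to 1, since `f g⁻¹` and `g f⁻¹` tend to the identity. -/
theorem continuousOn_coveringRadius_latticeMap [NeZero d]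
    (L : Submodule ℤ (EuclideanSpace ℝ (Fin d))) [DiscreteTopology L] [IsZLattice ℝ L] :
    ContinuousOn (fun g => coveringRadius (latticeMap g L)) {g | g.det ≠ 0} := by
  intro g hg
  have hinv : ∀ f : EuclideanSpace ℝ (Fin d) →L[ℝ] EuclideanSpace ℝ (Fin d), f.det ≠ 0 →
      IsUnit f := fun f hf => by
    rw [← coe_equivOfDetNeZero hf]
    exact ⟨(ContinuousLinearEquiv.unitsEquiv ℝ _).symm (equivOfDetNeZero f hf), rfl⟩
  have hup : ∀ f, f.det ≠ 0 → coveringRadius (latticeMap f L) ≤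
      ‖f * Ring.inverse g‖ * coveringRadius (latticeMap g L) := fun f hf =>
    coveringRadius_latticeMap_le _ (by
      change f * Ring.inverse g * g = f
      rw [mul_assoc, Ring.inverse_mul_cancel g (hinv g hg), mul_one]) hf hg L
  have hlo : ∀ f, f.det ≠ 0 → coveringRadius (latticeMap g L) ≤
      ‖g * Ring.inverse f‖ * coveringRadius (latticeMap f L) := fun f hf =>
    coveringRadius_latticeMap_le _ (by
      change g * Ring.inverse f * f = g
      rw [mul_assoc, Ring.inverse_mul_cancel f (hinv f hf), mul_one]) hg hf L
  have hone : ‖(1 : EuclideanSpace ℝ (Fin d) →L[ℝ] EuclideanSpace ℝ (Fin d))‖ = 1 := norm_one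
  obtain ⟨u, hu⟩ := hinv g hg
  have hc : ContinuousAt Ring.inverse g := hu ▸ NormedRing.inverse_continuousAt u
  have t1 : Filter.Tendsto (fun f => ‖f * Ring.inverse g‖ * coveringRadius (latticeMap g L))
      (nhdsWithin g {g | g.det ≠ 0}) (nhds (coveringRadius (latticeMap g L))) := by
    have : ContinuousAt (fun f => ‖f * Ring.inverse g‖ * coveringRadius (latticeMap g L)) g := by
      fun_prop
    have h := this.tendsto
    rw [Ring.mul_inverse_cancel g (hinv g hg), hone, one_mul] at h
    exact h.mono_left nhdsWithin_le_nhds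
  have t2 : Filter.Tendsto (fun f => ‖g * Ring.inverse f‖⁻¹ * coveringRadius (latticeMap g L))
      (nhdsWithin g {g | g.det ≠ 0}) (nhds (coveringRadius (latticeMap g L))) := by
    have h1 : ContinuousAt (fun f => ‖g * Ring.inverse f‖) g :=
      (continuousAt_const.mul hc).norm
    have h2 : ‖g * Ring.inverse g‖ = 1 := by
      rw [Ring.mul_inverse_cancel g (hinv g hg), hone]
    have : ContinuousAt (fun f => ‖g * Ring.inverse f‖⁻¹ * coveringRadius (latticeMap g L)) g :=
      (h1.inv₀ (by rw [h2]; exact one_ne_zero)).mul continuousAt_const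
    have h := this.tendsto
    rw [h2, inv_one, one_mul] at h
    exact h.mono_left nhdsWithin_le_nhds
  refine tendsto_of_tendsto_of_tendsto_of_le_of_le' t2 t1 ?_ ?_
  · filter_upwards [self_mem_nhdsWithin] with f hf
    -- If the norm vanishes, its inverse is 0 by convention and the bound is trivial.
    rcases eq_or_lt_of_le (norm_nonneg (g * Ring.inverse f)) with h0 | h0
    · rw [← h0]
      simpa using coveringRadius_nonneg _
    · rw [inv_mul_le_iff₀ h0]
      exact hlo f hf
  · filter_upwards [self_mem_nhdsWithin] with f hf
    exact hup f hf

theorem isWellRoundedUnimodular_latticeMap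
    {g : EuclideanSpace ℝ (Fin d) →L[ℝ] EuclideanSpace ℝ (Fin d)}
    (hg : g.det ≠ 0) {L : Submodule ℤ (EuclideanSpace ℝ (Fin d))} [DiscreteTopology L]
    [IsZLattice ℝ L] (hcov : |g.det| * ZLattice.covolume L = 1) {ι : Type*}
    {v : ι → EuclideanSpace ℝ (Fin d)} (hspan : Submodule.span ℝ (Set.range v) = ⊤)
    (hvL : ∀ i, v i ∈ L) (hv0 : ∀ i, v i ≠ 0)
    (hv : ∀ i, ∀ w ∈ L, w ≠ 0 → ‖g (v i)‖ ≤ ‖g w‖) :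
    IsWellRoundedUnimodular (latticeMap g L) := by
  refine ⟨discreteTopology_latticeMap hg L, isZLattice_latticeMap hg L,
    by rw [covolume_latticeMap hg L, hcov], ?_⟩
  have hinj : Function.Injective g := by
    rw [← coe_equivOfDetNeZero hg]
    exact (equivOfDetNeZero g hg).injective
  have hsurj : Function.Surjective g := by
    rw [← coe_equivOfDetNeZero hg]
    exact (equivOfDetNeZero g hg).surjective
  have hsub : g.toLinearMap '' (Set.range v) ⊆ {v | IsShortestVector (latticeMap g L) v} := by
    rintro _ ⟨_, ⟨i, rfl⟩, rfl⟩
    refine ⟨⟨v i, hvL i, rfl⟩, fun h => hv0 i (hinj (by simpa using h)), ?_⟩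
    rintro _ ⟨w, hw, rfl⟩ hw0
    exact hv i w hw (fun h => hw0 (by simp [h]))
  rw [IsWellRounded, eq_top_iff]
  refine le_trans ?_ (Submodule.span_mono hsub)
  rw [Submodule.span_image, hspan, Submodule.map_top, LinearMap.range_eq_top.2 hsurj]

end LinearImage

/-! ### The integer lattice. -/

section IntLattice

variable {d : ℕ}

theorem mem_intLattice_iff {x : EuclideanSpace ℝ (Fin d)} :
    x ∈ intLattice d ↔ ∃ z : Fin d → ℤ, ∀ i, x i = z i := by
  rw [intLattice, ← OrthonormalBasis.coe_toBasis, Module.Basis.mem_span_iff_repr_mem]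
  simp only [OrthonormalBasis.coe_toBasis_repr_apply, EuclideanSpace.basisFun_repr]
  constructor
  · intro h
    choose z hz using h
    exact ⟨z, fun i => (hz i).symm⟩
  · rintro ⟨z, hz⟩ i
    exact ⟨z i, (hz i).symm⟩

instance discreteTopology_intLattice : DiscreteTopology (intLattice d) := by
  rw [intLattice, ← OrthonormalBasis.coe_toBasis]
  infer_instance

instance isZLattice_intLattice : IsZLattice ℝ (intLattice d) := by
  refine ⟨?_⟩
  rw [intLattice, ← OrthonormalBasis.coe_toBasis]
  exact ZSpan.span_top _

theorem covolume_intLattice : ZLattice.covolume (intLattice d) = 1 := by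
  have hfd : MeasureTheory.IsAddFundamentalDomain (intLattice d)
      (ZSpan.fundamentalDomain (EuclideanSpace.basisFun (Fin d) ℝ).toBasis)
      MeasureTheory.volume := by
    have heq : intLattice d = Submodule.span ℤ
        (Set.range (EuclideanSpace.basisFun (Fin d) ℝ).toBasis) := by
      rw [intLattice, OrthonormalBasis.coe_toBasis]
    rw [heq]
    exact ZSpan.isAddFundamentalDomain _ _
  rw [ZLattice.covolume_eq_measure_fundamentalDomain (intLattice d) _ hfd,
    MeasureTheory.measureReal_congr (ZSpan.fundamentalDomain_ae_parallelepiped _ _),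
    OrthonormalBasis.coe_toBasis, MeasureTheory.measureReal_def,
    OrthonormalBasis.volume_parallelepiped, ENNReal.toReal_one]

theorem basisFun_mem_intLattice (i : Fin d) :
    EuclideanSpace.basisFun (Fin d) ℝ i ∈ intLattice d :=
  Submodule.subset_span ⟨i, rfl⟩

theorem span_basisFun :
    Submodule.span ℝ (Set.range (EuclideanSpace.basisFun (Fin d) ℝ)) = ⊤ := by
  rw [← OrthonormalBasis.coe_toBasis]
  exact Module.Basis.span_eq _

theorem one_le_norm_of_mem_intLattice {w : EuclideanSpace ℝ (Fin d)} (hw : w ∈ intLattice d)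
    (h0 : w ≠ 0) : 1 ≤ ‖w‖ := by
  obtain ⟨z, hz⟩ := mem_intLattice_iff.1 hw
  obtain ⟨i, hi⟩ : ∃ i, w i ≠ 0 := by
    by_contra! h
    exact h0 (by ext i; simpa using h i)
  refine le_trans ?_ (PiLp.norm_apply_le w i)
  rw [hz i] at hi ⊢
  rw [Real.norm_eq_abs]
  exact_mod_cast Int.one_le_abs (Int.cast_ne_zero.1 hi)

theorem isWellRoundedUnimodular_intLattice : IsWellRoundedUnimodular (intLattice d) := by
  refine ⟨inferInstance, inferInstance, covolume_intLattice, ?_⟩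
  rw [IsWellRounded, eq_top_iff, ← span_basisFun]
  refine Submodule.span_mono ?_
  rintro _ ⟨i, rfl⟩
  have h1 : ‖EuclideanSpace.basisFun (Fin d) ℝ i‖ = 1 := OrthonormalBasis.norm_eq_one _ _
  refine ⟨basisFun_mem_intLattice i, fun h => ?_, fun w hw h0 => ?_⟩
  · rw [h, norm_zero] at h1
    exact zero_ne_one h1
  · rw [h1]
    exact one_le_norm_of_mem_intLattice hw h0

theorem coveringRadius_intLattice : coveringRadius (intLattice d) = √(d : ℝ) / 2 := by
  have hd : √(d : ℝ) / 2 = √(∑ _i : Fin d, (1 / 2 : ℝ) ^ 2) := by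
    rw [Finset.sum_const, Finset.card_univ, Fintype.card_fin, nsmul_eq_mul,
      Real.sqrt_mul (Nat.cast_nonneg d), Real.sqrt_sq (by norm_num)]
    ring
  refine le_antisymm (coveringRadius_le fun x => ?_)
    (le_coveringRadius (WithLp.toLp 2 fun _ => 1 / 2) fun w hw => ?_)
  · refine ⟨WithLp.toLp 2 fun i => (round (x i) : ℝ),
      mem_intLattice_iff.2 ⟨fun i => round (x i), fun i => rfl⟩, ?_⟩
    rw [EuclideanSpace.norm_eq, hd]
    refine Real.sqrt_le_sqrt (Finset.sum_le_sum fun i _ => ?_)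
    refine pow_le_pow_left₀ (norm_nonneg _) ?_ 2
    simpa using abs_sub_round (x i)
  · obtain ⟨z, hz⟩ := mem_intLattice_iff.1 hw
    rw [EuclideanSpace.norm_eq, hd]
    refine Real.sqrt_le_sqrt (Finset.sum_le_sum fun i _ => ?_)
    rw [Real.norm_eq_abs, sq_abs, PiLp.sub_apply, hz i]
    have : (0 : ℤ) ≤ z i * (z i - 1) := by
      rcases le_or_gt (z i) 0 with h | h
      · nlinarith
      · nlinarith
    have h2 : (0 : ℝ) ≤ z i * (z i - 1) := by exact_mod_cast this
    change (1 / 2 : ℝ) ^ 2 ≤ (1 / 2 - z i) ^ 2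
    nlinarith

end IntLattice

/-! ### The maximum `N_d` is attained. -/

section Existence

variable {d : ℕ}

/-- Minkowski's theorem; any bound depending on `d` alone will do. With `c` the volume of the unit
ball, `(1 + 1/c)^d c ≥ c + 1 > 1`, so the chosen ball is large enough. -/
theorem exists_short_vector_bound (d : ℕ) [NeZero d] :
    ∃ B : ℝ, ∀ (L : Submodule ℤ (EuclideanSpace ℝ (Fin d))) [DiscreteTopology L]
      [IsZLattice ℝ L], ZLattice.covolume L = 1 → ∃ x ∈ L, x ≠ 0 ∧ ‖x‖ ≤ B := by
  set c := MeasureTheory.volume.real (Metric.ball (0 : EuclideanSpace ℝ (Fin d)) 1) with hc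
  have hcpos : 0 < c := ENNReal.toReal_pos (Metric.measure_ball_pos _ _ one_pos).ne'
    MeasureTheory.measure_ball_lt_top.ne
  have hB : 0 ≤ 2 * (1 + 1 / c) := by positivity
  refine ⟨2 * (1 + 1 / c), fun L _ _ hL => ?_⟩
  have hfund := ZLattice.isAddFundamentalDomain (Module.Free.chooseBasis ℤ L)
    (MeasureTheory.volume : MeasureTheory.Measure (EuclideanSpace ℝ (Fin d)))
  set F := ZSpan.fundamentalDomain ((Module.Free.chooseBasis ℤ L).ofZLatticeBasis ℝ)
  have hF : MeasureTheory.volume F = 1 := by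
    have h := ZLattice.covolume_eq_measure_fundamentalDomain L MeasureTheory.volume hfund
    rw [hL, MeasureTheory.measureReal_def, eq_comm, ENNReal.toReal_eq_one_iff] at h
    exact h
  have : Countable L.toAddSubgroup := (inferInstance : Countable L)
  have hlt : MeasureTheory.volume F * 2 ^ Module.finrank ℝ (EuclideanSpace ℝ (Fin d)) <
      MeasureTheory.volume (Metric.closedBall (0 : EuclideanSpace ℝ (Fin d))
        (2 * (1 + 1 / c))) := by
    have hreal : (2 : ℝ) ^ d < (2 * (1 + 1 / c)) ^ d * c := by
      have h1 : 1 + 1 / c ≤ (1 + 1 / c) ^ d :=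
        le_self_pow₀ (by simp [hcpos.le]) (NeZero.ne d)
      have h2 : (1 + 1 / c) * c = c + 1 := by field_simp
      have h3 : 1 < (1 + 1 / c) ^ d * c := by
        nlinarith [mul_le_mul_of_nonneg_right h1 hcpos.le]
      rw [mul_pow, mul_assoc]
      exact lt_mul_of_one_lt_right (by positivity) h3
    have htwo : (2 : ENNReal) ^ d = ENNReal.ofReal (2 ^ d) := by
      rw [ENNReal.ofReal_pow zero_le_two, ENNReal.ofReal_ofNat]
    rw [hF, one_mul, MeasureTheory.Measure.addHaar_closedBall _ _ hB, finrank_euclideanSpace,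
      Fintype.card_fin, ← MeasureTheory.ofReal_measureReal MeasureTheory.measure_ball_lt_top.ne,
      ← ENNReal.ofReal_mul (by positivity), htwo]
    exact (ENNReal.ofReal_lt_ofReal_iff_of_nonneg (by positivity)).2 hreal
  obtain ⟨x, hx0, hx⟩ :=
    MeasureTheory.exists_ne_zero_mem_lattice_of_measure_mul_two_pow_lt_measure
      (L := L.toAddSubgroup) hfund
      (fun x hx => by simpa using hx) (convex_closedBall 0 _) hlt
  exact ⟨x, x.2, fun h => hx0 (Subtype.ext h), by simpa using hx⟩

/-- An intermediate `L` is determined by its points in a ball containing a fundamental domain of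
`M`, and `W` has finitely many points there. -/
theorem finite_setOf_between (M W : Submodule ℤ (EuclideanSpace ℝ (Fin d))) [DiscreteTopology M]
    [IsZLattice ℝ M] [DiscreteTopology W] : {L | M ≤ L ∧ L ≤ W}.Finite := by
  let b := Module.Free.chooseBasis ℤ M
  let β := b.ofZLatticeBasis ℝ M
  let R := ∑ i, ‖β i‖
  have hfin : ((Metric.closedBall 0 R : Set (EuclideanSpace ℝ (Fin d))) ∩ W).Finite := by
    change ((_ : Set (EuclideanSpace ℝ (Fin d))) ∩ W.toAddSubgroup).Finite
    have : DiscreteTopology W.toAddSubgroup := (inferInstance : DiscreteTopology W)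
    exact Metric.finite_isBounded_inter_isClosed DiscreteTopology.isDiscrete
      Metric.isBounded_closedBall inferInstance
  refine Set.Finite.of_finite_image (f := fun L : Submodule ℤ (EuclideanSpace ℝ (Fin d)) =>
    (Metric.closedBall 0 R : Set (EuclideanSpace ℝ (Fin d))) ∩ L) ?_ ?_
  · refine hfin.finite_subsets.subset ?_
    rintro _ ⟨L, hL, rfl⟩
    exact Set.inter_subset_inter_right _ hL.2
  · have key : ∀ L L' : Submodule ℤ (EuclideanSpace ℝ (Fin d)), M ≤ L → M ≤ L' →
        (Metric.closedBall 0 R : Set (EuclideanSpace ℝ (Fin d))) ∩ L ⊆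
          (Metric.closedBall 0 R : Set (EuclideanSpace ℝ (Fin d))) ∩ L' → L ≤ L' := by
      intro L L' hL hL' h x hx
      have hfl : (ZSpan.floor β x : EuclideanSpace ℝ (Fin d)) ∈ M :=
        (b.ofZLatticeBasis_span ℝ M).le (ZSpan.floor β x).2
      have hfr : ZSpan.fract β x ∈ L' := by
        refine (h ⟨?_, L.sub_mem hx (hL hfl)⟩).2
        rw [mem_closedBall_zero_iff]
        exact ZSpan.norm_fract_le β x
      have := L'.add_mem hfr (hL' hfl)
      rwa [ZSpan.fract_apply, sub_add_cancel] at this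
    intro L hL L' hL' h
    exact le_antisymm (key L L' hL.1 hL'.1 h.le) (key L' L hL'.1 hL.1 h.ge)

/-- The linear maps `g` that send the standard basis to shortest vectors, of norm at most `B`, of a
unimodular lattice `g L`. -/
def shortBasisMaps (L : Submodule ℤ (EuclideanSpace ℝ (Fin d))) (B : ℝ) :
    Set (EuclideanSpace ℝ (Fin d) →L[ℝ] EuclideanSpace ℝ (Fin d)) :=
  {g | (∀ i, ‖g (EuclideanSpace.basisFun (Fin d) ℝ i)‖ ≤ B) ∧
    |g.det| * ZLattice.covolume L = 1 ∧
    ∀ i, ∀ w ∈ L, w ≠ 0 → ‖g (EuclideanSpace.basisFun (Fin d) ℝ i)‖ ≤ ‖g w‖}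

theorem norm_le_of_norm_basisFun_le
    {g : EuclideanSpace ℝ (Fin d) →L[ℝ] EuclideanSpace ℝ (Fin d)} {B : ℝ}
    (hg : ∀ i, ‖g (EuclideanSpace.basisFun (Fin d) ℝ i)‖ ≤ B) : ‖g‖ ≤ d * |B| := by
  refine g.opNorm_le_bound (by positivity) fun x => ?_
  have hx : x = ∑ i, x i • EuclideanSpace.basisFun (Fin d) ℝ i := by
    conv_lhs => rw [← (EuclideanSpace.basisFun (Fin d) ℝ).sum_repr x]
    simp only [EuclideanSpace.basisFun_repr]
  conv_lhs => rw [hx, map_sum]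
  refine (norm_sum_le _ _).trans ?_
  have : ∀ i ∈ (Finset.univ : Finset (Fin d)),
      ‖g (x i • EuclideanSpace.basisFun (Fin d) ℝ i)‖ ≤ ‖x‖ * |B| := fun i _ => by
    rw [map_smul, norm_smul]
    exact mul_le_mul (PiLp.norm_apply_le x i) ((hg i).trans (le_abs_self B)) (norm_nonneg _)
      (norm_nonneg _)
  refine (Finset.sum_le_card_nsmul _ _ _ this).trans (le_of_eq ?_)
  rw [Finset.card_univ, Fintype.card_fin, nsmul_eq_mul]
  ring

/-- All the conditions are closed, and bounding the images of the basis bounds the norm. The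
covolume condition keeps the determinant away from 0 in the limit. -/
theorem isCompact_shortBasisMaps (L : Submodule ℤ (EuclideanSpace ℝ (Fin d))) (B : ℝ) :
    IsCompact (shortBasisMaps L B) := by
  refine Metric.isCompact_of_isClosed_isBounded ?_ ?_
  · have hev : ∀ x : EuclideanSpace ℝ (Fin d),
        Continuous fun g : EuclideanSpace ℝ (Fin d) →L[ℝ] EuclideanSpace ℝ (Fin d) => ‖g x‖ :=
      fun x => by fun_prop
    simp only [shortBasisMaps, Set.ofPred_and, Set.ofPred_forall]
    refine (isClosed_iInter fun i => isClosed_le (hev _) continuous_const).inter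
      (IsClosed.inter ?_ ?_)
    · exact isClosed_eq (ContinuousLinearMap.continuous_det.abs.mul continuous_const)
        continuous_const
    · exact isClosed_iInter fun i => isClosed_iInter fun w => isClosed_iInter fun _ =>
        isClosed_iInter fun _ => isClosed_le (hev _) (hev _)
  · refine (Metric.isBounded_closedBall (x := 0) (r := d * |B|)).subset fun g hg => ?_
    rw [mem_closedBall_zero_iff]
    exact norm_le_of_norm_basisFun_le hg.1

theorem det_ne_zero_of_mem_shortBasisMaps {L : Submodule ℤ (EuclideanSpace ℝ (Fin d))} {B : ℝ}
    {g : EuclideanSpace ℝ (Fin d) →L[ℝ] EuclideanSpace ℝ (Fin d)} (hg : g ∈ shortBasisMaps L B) :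
    g.det ≠ 0 := fun h => by
  have := hg.2.1
  rw [h, abs_zero, zero_mul] at this
  exact zero_ne_one this

theorem isWellRoundedUnimodular_of_mem_shortBasisMaps
    {L : Submodule ℤ (EuclideanSpace ℝ (Fin d))} [DiscreteTopology L] [IsZLattice ℝ L] {B : ℝ}
    (hL : intLattice d ≤ L)
    {g : EuclideanSpace ℝ (Fin d) →L[ℝ] EuclideanSpace ℝ (Fin d)} (hg : g ∈ shortBasisMaps L B) :
    IsWellRoundedUnimodular (latticeMap g L) :=
  isWellRoundedUnimodular_latticeMap (det_ne_zero_of_mem_shortBasisMaps hg) hg.2.1 span_basisFun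
    (fun i => hL (basisFun_mem_intLattice i))
    (fun i h => by
      have h1 : ‖EuclideanSpace.basisFun (Fin d) ℝ i‖ = 1 := OrthonormalBasis.norm_eq_one _ _
      rw [h, norm_zero] at h1
      exact zero_ne_one h1) hg.2.2

theorem exists_basis_shortest {L : Submodule ℤ (EuclideanSpace ℝ (Fin d))}
    (hL : IsWellRounded L) : ∃ β : Module.Basis (Fin d) ℝ (EuclideanSpace ℝ (Fin d)),
      ∀ i, IsShortestVector L (β i) := by
  obtain ⟨s, hs, hspan, hli⟩ := exists_linearIndependent ℝ {v | IsShortestVector L v}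
  rw [hL] at hspan
  let β₀ : Module.Basis s ℝ (EuclideanSpace ℝ (Fin d)) := Module.Basis.mk hli (by
    rw [Subtype.range_coe_subtype]
    exact hspan.ge)
  have : Fintype s := Module.Basis.fintypeIndexOfRankLtAleph0 β₀ (Module.rank_lt_aleph0 _ _)
  have hcard : Fintype.card s = d := by
    rw [← Module.finrank_eq_card_basis β₀, finrank_euclideanSpace, Fintype.card_fin]
  let e : s ≃ Fin d := Fintype.equivFinOfCardEq hcard
  refine ⟨β₀.reindex e, fun i => ?_⟩
  rw [Module.Basis.reindex_apply, Module.Basis.mk_apply]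
  exact hs (e.symm i).2

/-- Change coordinates so that a basis of shortest vectors becomes the standard one. Then `ℤ^d` has
index `|det e|` in the new lattice, and this is bounded because Minkowski bounds the shortest
vectors. -/
theorem exists_shortBasisMaps_bound [NeZero d] : ∃ (B : ℝ) (K : ℕ),
    ∀ L : Submodule ℤ (EuclideanSpace ℝ (Fin d)), IsWellRoundedUnimodular L →
      ∃ (L₀ : Submodule ℤ (EuclideanSpace ℝ (Fin d)))
        (g : EuclideanSpace ℝ (Fin d) →L[ℝ] EuclideanSpace ℝ (Fin d)),
        intLattice d ≤ L₀ ∧ (∀ x ∈ L₀, K.factorial • x ∈ intLattice d) ∧ g ∈ shortBasisMaps L₀ B ∧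
          latticeMap g L₀ = L := by
  obtain ⟨B, hB⟩ := exists_short_vector_bound d
  obtain ⟨K, hK⟩ : ∃ K : ℕ, ∀ g : EuclideanSpace ℝ (Fin d) →L[ℝ] EuclideanSpace ℝ (Fin d),
      ‖g‖ ≤ d * |B| → |g.det| ≤ K := by
    obtain ⟨C, hC⟩ := (isCompact_closedBall
      (0 : EuclideanSpace ℝ (Fin d) →L[ℝ] EuclideanSpace ℝ (Fin d))
        (d * |B|)).exists_bound_of_continuousOn ContinuousLinearMap.continuous_det.continuousOn
    refine ⟨⌈C⌉₊, fun g hg => (hC g (mem_closedBall_zero_iff.2 hg)).trans (Nat.le_ceil C)⟩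
  refine ⟨B, K, fun L hL => ?_⟩
  have := hL.discrete
  have := hL.isZLattice
  obtain ⟨β, hβ⟩ := exists_basis_shortest hL.wellRounded
  let e : EuclideanSpace ℝ (Fin d) ≃L[ℝ] EuclideanSpace ℝ (Fin d) :=
    ((EuclideanSpace.basisFun (Fin d) ℝ).toBasis.equiv β (Equiv.refl _)).toContinuousLinearEquiv
  have he : ∀ i, e (EuclideanSpace.basisFun (Fin d) ℝ i) = β i := fun i => by
    rw [← OrthonormalBasis.coe_toBasis]
    exact Module.Basis.equiv_apply _ _ _ _
  have hdet : ∀ f : EuclideanSpace ℝ (Fin d) ≃L[ℝ] EuclideanSpace ℝ (Fin d),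
      (f : EuclideanSpace ℝ (Fin d) →L[ℝ] EuclideanSpace ℝ (Fin d)).det ≠ 0 := fun f =>
    (LinearEquiv.isUnit_det' f.toLinearEquiv).ne_zero
  let L₀ := latticeMap e.symm L
  have : DiscreteTopology L₀ := discreteTopology_latticeMap (hdet _) L
  have : IsZLattice ℝ L₀ := isZLattice_latticeMap (hdet _) L
  have hmap : latticeMap e L₀ = L := by
    ext x
    constructor
    · rintro ⟨_, ⟨w, hw, rfl⟩, rfl⟩
      change e (e.symm w) ∈ L
      rwa [e.apply_symm_apply]
    · intro hx
      exact ⟨e.symm x, ⟨x, hx, rfl⟩, e.apply_symm_apply x⟩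
  have hle : intLattice d ≤ L₀ := by
    rw [intLattice, Submodule.span_le]
    rintro _ ⟨i, rfl⟩
    refine ⟨β i, (hβ i).1, ?_⟩
    rw [← he i]
    exact e.symm_apply_apply _
  have hcov : |(e : EuclideanSpace ℝ (Fin d) →L[ℝ] EuclideanSpace ℝ (Fin d)).det| *
      ZLattice.covolume L₀ = 1 := by
    rw [← covolume_latticeMap (hdet e) L₀, hmap, hL.covolume_eq_one]
  obtain ⟨x, hxL, hx0, hxB⟩ := hB L hL.covolume_eq_one
  have hshort : ∀ i, ‖e (EuclideanSpace.basisFun (Fin d) ℝ i)‖ ≤ B := fun i => by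
    rw [he]
    exact ((hβ i).2.2 x hxL hx0).trans hxB
  have hidx : ((intLattice d).toAddSubgroup.relIndex L₀.toAddSubgroup : ℝ) =
      |(e : EuclideanSpace ℝ (Fin d) →L[ℝ] EuclideanSpace ℝ (Fin d)).det| := by
    rw [← ZLattice.covolume_div_covolume_eq_relIndex' _ _ hle, covolume_intLattice,
      eq_comm, eq_div_iff (ZLattice.covolume_ne_zero L₀ _), hcov]
  refine ⟨L₀, e, hle, fun x hx => ?_, ⟨hshort, hcov, fun i w hw hw0 => ?_⟩, hmap⟩
  · have hne : (intLattice d).toAddSubgroup.relIndex L₀.toAddSubgroup ≠ 0 := fun h => by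
      rw [h, Nat.cast_zero, eq_comm, abs_eq_zero] at hidx
      exact hdet e hidx
    have hleK : (intLattice d).toAddSubgroup.relIndex L₀.toAddSubgroup ≤ K := by
      have := hK e (norm_le_of_norm_basisFun_le hshort)
      rw [← hidx] at this
      exact_mod_cast this
    -- Some multiple `m x` with `0 < m ≤ index ≤ K` lies in `ℤ^d`, and every such `m` divides `K!`.
    exact (AddSubgroup.nsmul_mem_of_relIndex_ne_zero_of_dvd hne (a := x) hx
      (fun m hm hmle => Nat.dvd_factorial hm (hmle.trans hleK))).1
  · rw [ContinuousLinearEquiv.coe_coe, he]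
    refine (hβ i).2.2 _ (hmap.le ⟨w, hw, rfl⟩) fun h => hw0 ?_
    exact e.injective (by rw [h, map_zero])

/-- Finitely many lattices lie between `ℤ^d` and `(1/K!) ℤ^d`; each contributes the continuous image
of a compact set. -/
theorem isCompact_woodsRadii [NeZero d] : IsCompact (woodsRadii d) := by
  obtain ⟨B, K, hBK⟩ := exists_shortBasisMaps_bound (d := d)
  let c : EuclideanSpace ℝ (Fin d) →L[ℝ] EuclideanSpace ℝ (Fin d) :=
    ((K.factorial : ℝ)⁻¹) • ContinuousLinearMap.id ℝ _
  have hK0 : (K.factorial : ℝ) ≠ 0 := Nat.cast_ne_zero.2 K.factorial_ne_zero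
  have hc : c.det ≠ 0 := by
    simp [c, ContinuousLinearMap.det, K.factorial_ne_zero]
  have : DiscreteTopology (latticeMap c (intLattice d)) := discreteTopology_latticeMap hc _
  have hfin := finite_setOf_between (intLattice d) (latticeMap c (intLattice d))
  have heq : woodsRadii d = ⋃ L ∈ {L | intLattice d ≤ L ∧ L ≤ latticeMap c (intLattice d)},
      (fun g => coveringRadius (latticeMap g L)) '' shortBasisMaps L B := by
    ext r
    simp only [Set.mem_iUnion]
    constructor
    · rintro ⟨L, hL, rfl⟩
      obtain ⟨L₀, g, h1, h2, h3, rfl⟩ := hBK L hL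
      refine ⟨L₀, ⟨h1, fun x hx => ⟨_, h2 x hx, ?_⟩⟩, g, h3, rfl⟩
      change (K.factorial : ℝ)⁻¹ • (K.factorial • x) = x
      rw [← Nat.cast_smul_eq_nsmul ℝ, smul_smul, inv_mul_cancel₀ hK0, one_smul]
    · rintro ⟨L, ⟨h1, h2⟩, g, hg, rfl⟩
      have : DiscreteTopology L := DiscreteTopology.of_subset (t := L) ‹_› h2
      have : IsZLattice ℝ L := ⟨top_le_iff.1 <|
        (isZLattice_intLattice (d := d)).span_top.ge.trans (Submodule.span_mono h1)⟩
      exact ⟨_, isWellRoundedUnimodular_of_mem_shortBasisMaps h1 hg, rfl⟩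
  rw [heq]
  refine hfin.isCompact_biUnion fun L hL => ?_
  have : DiscreteTopology L := DiscreteTopology.of_subset (t := L) ‹_› hL.2
  have : IsZLattice ℝ L := ⟨top_le_iff.1 <|
    (isZLattice_intLattice (d := d)).span_top.ge.trans (Submodule.span_mono hL.1)⟩
  exact (isCompact_shortBasisMaps L B).image_of_continuousOn
    ((continuousOn_coveringRadius_latticeMap L).mono fun g hg =>
      det_ne_zero_of_mem_shortBasisMaps hg)

theorem isGreatest_woodsN (hd : 1 ≤ d) : IsGreatest (woodsRadii d) (woodsN d) := by
  have : NeZero d := ⟨by lia⟩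
  exact isCompact_woodsRadii.isGreatest_sSup
    ⟨_, intLattice d, isWellRoundedUnimodular_intLattice, rfl⟩

theorem coveringRadius_le_woodsN (hd : 1 ≤ d) {L : Submodule ℤ (EuclideanSpace ℝ (Fin d))}
    (hL : IsWellRoundedUnimodular L) : coveringRadius L ≤ woodsN d :=
  (isGreatest_woodsN hd).2 ⟨L, hL, rfl⟩

end Existence

/-! ### Construction A: lattices from codes modulo `q`. -/

section ConstructionA

variable {d q : ℕ}

/-- The inclusion of `ℤ^d` in `ℝ^d`. -/
noncomputable def intVector (d : ℕ) : (Fin d → ℤ) →+ EuclideanSpace ℝ (Fin d) where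
  toFun x := WithLp.toLp 2 fun i => (x i : ℝ)
  map_zero' := by ext i; simp
  map_add' x y := by ext i; simp

@[simp]
theorem intVector_apply (x : Fin d → ℤ) (i : Fin d) : intVector d x i = x i := rfl

theorem intVector_injective : Function.Injective (intVector d) := fun x y h => by
  funext i
  have : intVector d x i = intVector d y i := by rw [h]
  exact Int.cast_injective (α := ℝ) this

theorem norm_sq_intVector (x : Fin d → ℤ) : ‖intVector d x‖ ^ 2 = ((∑ i, x i ^ 2 : ℤ) : ℝ) := by
  rw [EuclideanSpace.norm_sq_eq]
  simp

/-- Reduction of integer vectors modulo `q`. -/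
def modVector (d q : ℕ) : (Fin d → ℤ) →+ (Fin d → ZMod q) where
  toFun x i := x i
  map_zero' := by ext i; simp
  map_add' x y := by ext i; simp

@[simp]
theorem modVector_apply (x : Fin d → ℤ) (i : Fin d) : modVector d q x i = x i := rfl

theorem modVector_surjective : Function.Surjective (modVector d q) := fun y => by
  choose x hx using fun i => ZMod.intCast_surjective (y i)
  exact ⟨x, funext hx⟩

/-- The lattice of integer vectors that reduce to codewords of `C` modulo `q`. -/
noncomputable def codeLattice (C : AddSubgroup (Fin d → ZMod q)) :
    Submodule ℤ (EuclideanSpace ℝ (Fin d)) :=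
  AddSubgroup.toIntSubmodule ((C.comap (modVector d q)).map (intVector d))

theorem mem_codeLattice {C : AddSubgroup (Fin d → ZMod q)} {w : EuclideanSpace ℝ (Fin d)} :
    w ∈ codeLattice C ↔ ∃ x, modVector d q x ∈ C ∧ intVector d x = w := Iff.rfl

theorem codeLattice_le_intLattice (C : AddSubgroup (Fin d → ZMod q)) :
    codeLattice C ≤ intLattice d := by
  rintro _ ⟨x, -, rfl⟩
  exact mem_intLattice_iff.2 ⟨x, fun i => rfl⟩

instance discreteTopology_codeLattice (C : AddSubgroup (Fin d → ZMod q)) :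
    DiscreteTopology (codeLattice C) :=
  DiscreteTopology.of_subset (discreteTopology_intLattice (d := d)) (codeLattice_le_intLattice C)

theorem smul_basisFun_mem_codeLattice (C : AddSubgroup (Fin d → ZMod q)) (i : Fin d) :
    (q : ℝ) • EuclideanSpace.basisFun (Fin d) ℝ i ∈ codeLattice C := by
  refine ⟨Pi.single i (q : ℤ), ?_, ?_⟩
  · have : modVector d q (Pi.single i (q : ℤ)) = 0 := by
      ext j
      rcases eq_or_ne j i with rfl | h
      · simp
      · simp [h]
    change modVector d q _ ∈ C
    rw [this]
    exact C.zero_mem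
  · ext j
    rcases eq_or_ne j i with rfl | h
    · simp
    · simp [h]

theorem span_smul_basisFun [NeZero q] :
    Submodule.span ℝ (Set.range fun i => (q : ℝ) • EuclideanSpace.basisFun (Fin d) ℝ i) = ⊤ := by
  rw [eq_top_iff, ← span_basisFun, Submodule.span_le]
  rintro _ ⟨i, rfl⟩
  have hq : (q : ℝ) ≠ 0 := Nat.cast_ne_zero.2 (NeZero.ne q)
  have h := Submodule.smul_mem (Submodule.span ℝ
    (Set.range fun i => (q : ℝ) • EuclideanSpace.basisFun (Fin d) ℝ i)) (q : ℝ)⁻¹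
    (Submodule.subset_span ⟨i, rfl⟩)
  rwa [smul_smul, inv_mul_cancel₀ hq, one_smul] at h

instance isZLattice_codeLattice [NeZero q] (C : AddSubgroup (Fin d → ZMod q)) :
    IsZLattice ℝ (codeLattice C) := by
  refine ⟨top_le_iff.1 ((span_smul_basisFun (q := q)).ge.trans (Submodule.span_mono ?_))⟩
  rintro _ ⟨i, rfl⟩
  exact smul_basisFun_mem_codeLattice C i

theorem covolume_codeLattice [NeZero q] (C : AddSubgroup (Fin d → ZMod q)) :
    ZLattice.covolume (codeLattice C) = C.index := by
  have h := ZLattice.covolume_div_covolume_eq_relIndex' _ _ (codeLattice_le_intLattice C)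
  rw [covolume_intLattice, div_one] at h
  have h1 : (intLattice d).toAddSubgroup = (⊤ : AddSubgroup (Fin d → ℤ)).map (intVector d) := by
    ext x
    change x ∈ intLattice d ↔ _
    rw [mem_intLattice_iff]
    constructor
    · rintro ⟨z, hz⟩
      exact ⟨z, trivial, by ext i; simp [hz]⟩
    · rintro ⟨z, -, rfl⟩
      exact ⟨z, fun i => rfl⟩
  have h2 : (codeLattice C).toAddSubgroup = (C.comap (modVector d q)).map (intVector d) := rfl
  rw [h, h1, h2, AddSubgroup.relIndex_map_map_of_injective _ _ intVector_injective,
    AddSubgroup.relIndex_top_right, AddSubgroup.index_comap_of_surjective C modVector_surjective]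

/-- `hmin` makes the `q eᵢ` shortest vectors, and `p` is a hole at squared distance at least `R`.
The power of the index is the scaling to covolume one. -/
theorem index_rpow_mul_le_woodsN (hd : 1 ≤ d) [NeZero q] (C : AddSubgroup (Fin d → ZMod q))
    (hmin : ∀ x : Fin d → ℤ, x ≠ 0 → modVector d q x ∈ C → (q : ℤ) ^ 2 ≤ ∑ i, x i ^ 2)
    {R : ℝ} (p : EuclideanSpace ℝ (Fin d))
    (hp : ∀ x : Fin d → ℤ, modVector d q x ∈ C → R ≤ ∑ i, (p i - x i) ^ 2) :
    (C.index : ℝ) ^ (-(1 / d : ℝ)) * √R ≤ woodsN d := by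
  have hidx : (0 : ℝ) < C.index := by
    rw [← covolume_codeLattice]
    exact ZLattice.covolume_pos _ _
  have hd0 : (d : ℝ) ≠ 0 := by positivity
  set s : ℝ := (C.index : ℝ) ^ (-(1 / d : ℝ)) with hs
  have hspos : 0 < s := Real.rpow_pos_of_pos hidx _
  have hsd : s ^ d * C.index = 1 := by
    rw [hs, ← Real.rpow_natCast, ← Real.rpow_mul hidx.le, neg_mul, one_div,
      inv_mul_cancel₀ hd0, Real.rpow_neg_one, inv_mul_cancel₀ hidx.ne']
  let g : EuclideanSpace ℝ (Fin d) →L[ℝ] EuclideanSpace ℝ (Fin d) :=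
    s • ContinuousLinearMap.id ℝ _
  have hgdet : g.det = s ^ d := by
    simp [g, ContinuousLinearMap.det]
  have hg : g.det ≠ 0 := by
    rw [hgdet]
    positivity
  have hgn : ∀ x, ‖g x‖ = s * ‖x‖ := fun x => by
    change ‖s • x‖ = _
    rw [norm_smul, Real.norm_of_nonneg hspos.le]
  have hq : (0 : ℝ) < q := Nat.cast_pos.2 (NeZero.pos q)
  have hL : IsWellRoundedUnimodular (latticeMap g (codeLattice C)) := by
    refine isWellRoundedUnimodular_latticeMap hg ?_ span_smul_basisFun
      (smul_basisFun_mem_codeLattice C) (fun i h => ?_) (fun i w hw hw0 => ?_)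
    · rw [hgdet, covolume_codeLattice, abs_of_pos (by positivity), hsd]
    · have h1 : ‖(q : ℝ) • EuclideanSpace.basisFun (Fin d) ℝ i‖ = q := by
        rw [norm_smul, OrthonormalBasis.norm_eq_one, mul_one, Real.norm_of_nonneg hq.le]
      rw [h, norm_zero] at h1
      exact hq.ne h1
    · rw [hgn, hgn, norm_smul, OrthonormalBasis.norm_eq_one, mul_one, Real.norm_of_nonneg hq.le]
      refine mul_le_mul_of_nonneg_left ?_ hspos.le
      obtain ⟨x, hx, rfl⟩ := mem_codeLattice.1 hw
      refine le_of_sq_le_sq ?_ (norm_nonneg _)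
      rw [norm_sq_intVector]
      exact_mod_cast hmin x (fun h => hw0 (by rw [h, map_zero])) hx
  refine le_trans ?_ (coveringRadius_le_woodsN hd hL)
  have := hL.discrete
  have := hL.isZLattice
  refine le_coveringRadius (g p) ?_
  rintro _ ⟨_, ⟨x, hx, rfl⟩, rfl⟩
  change _ ≤ ‖g p - g (intVector d x)‖
  rw [← map_sub, hgn, EuclideanSpace.norm_eq]
  refine mul_le_mul_of_nonneg_left (Real.sqrt_le_sqrt ((hp x hx).trans (le_of_eq ?_))) hspos.le
  simp

end ConstructionA

/-! ### The binary code beating `√d / 2` for `d ≥ 30`. -/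

section PairedCode

variable {h m : ℕ}

/-- The parity checks of the code of the words `(a, a, 0)` with `a` of even weight. -/
def pairedParity (h m : ℕ) :
    (Fin (h + h + m) → ZMod 2) →+ (Fin h → ZMod 2) × ZMod 2 × (Fin m → ZMod 2) where
  toFun y := (fun k => y (Fin.castAdd m (Fin.castAdd h k)) - y (Fin.castAdd m (Fin.natAdd h k)),
    ∑ k, y (Fin.castAdd m (Fin.castAdd h k)), fun j => y (Fin.natAdd (h + h) j))
  map_zero' := by
    ext <;> simp
  map_add' x y := by
    ext
    · simp only [Pi.add_apply, Prod.fst_add]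
      ring
    · simp only [Pi.add_apply, Prod.snd_add, Prod.fst_add, Finset.sum_add_distrib]
    · rfl

theorem modVector_mem_ker_pairedParity {x : Fin (h + h + m) → ℤ}
    (hx : modVector (h + h + m) 2 x ∈ (pairedParity h m).ker) :
    (∀ k, (2 : ℤ) ∣ x (Fin.castAdd m (Fin.castAdd h k)) - x (Fin.castAdd m (Fin.natAdd h k))) ∧
    (2 : ℤ) ∣ ∑ k, x (Fin.castAdd m (Fin.castAdd h k)) ∧
    ∀ j, (2 : ℤ) ∣ x (Fin.natAdd (h + h) j) := by
  rw [AddMonoidHom.mem_ker, Prod.ext_iff, Prod.ext_iff] at hx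
  obtain ⟨h1, h2, h3⟩ := hx
  refine ⟨fun k => ?_, ?_, fun j => ?_⟩
  · have := congrFun h1 k
    refine (ZMod.intCast_zmod_eq_zero_iff_dvd _ 2).1 ?_
    push_cast
    exact this
  · refine (ZMod.intCast_zmod_eq_zero_iff_dvd _ 2).1 ?_
    push_cast
    exact h2
  · exact (ZMod.intCast_zmod_eq_zero_iff_dvd _ 2).1 (congrFun h3 j)

theorem index_ker_pairedParity_le : (pairedParity h m).ker.index ≤ 2 ^ (h + 1 + m) := by
  rw [AddSubgroup.index_ker]
  refine (Nat.card_le_card_of_injective _ Subtype.val_injective).trans (le_of_eq ?_)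
  simp only [Nat.card_eq_fintype_card, Fintype.card_prod, Fintype.card_pi, ZMod.card,
    Finset.prod_const, Finset.card_univ, Fintype.card_fin]
  ring

/-- Every squared norm is divisible by 4: a pair `a ≡ b` mod 2 has `a² + b² ≡ 2a` mod 4, the sum of
the `a` is even, and the remaining entries are even. -/
theorem four_le_sum_sq_of_mem_ker_pairedParity {x : Fin (h + h + m) → ℤ} (hx0 : x ≠ 0)
    (hx : modVector (h + h + m) 2 x ∈ (pairedParity h m).ker) : 4 ≤ ∑ i, x i ^ 2 := by
  obtain ⟨h1, h2, h3⟩ := modVector_mem_ker_pairedParity hx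
  have hpos : 0 < ∑ i, x i ^ 2 := by
    obtain ⟨i, hi⟩ := Function.ne_iff.1 hx0
    exact Finset.sum_pos' (fun j _ => sq_nonneg _) ⟨i, Finset.mem_univ i, by
      have : x i ≠ 0 := hi
      positivity⟩
  refine Int.le_of_dvd hpos ?_
  have hsplit : ∑ i, x i ^ 2 =
      ∑ k, (x (Fin.castAdd m (Fin.castAdd h k)) ^ 2 + x (Fin.castAdd m (Fin.natAdd h k)) ^ 2
        - 2 * x (Fin.castAdd m (Fin.castAdd h k))) +
      2 * ∑ k, x (Fin.castAdd m (Fin.castAdd h k)) + ∑ j, x (Fin.natAdd (h + h) j) ^ 2 := by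
    rw [Fin.sum_univ_add, Fin.sum_univ_add, Finset.sum_sub_distrib, Finset.sum_add_distrib,
      ← Finset.mul_sum]
    ring
  rw [hsplit]
  refine dvd_add (dvd_add (Finset.dvd_sum fun k _ => ?_) ?_) (Finset.dvd_sum fun j _ => ?_)
  · obtain ⟨t, ht⟩ := h1 k
    obtain ⟨s, hs⟩ := Int.even_mul_pred_self (x (Fin.castAdd m (Fin.castAdd h k)))
    have hb : x (Fin.castAdd m (Fin.natAdd h k)) =
        x (Fin.castAdd m (Fin.castAdd h k)) - 2 * t := by linarith
    rw [hb]
    exact ⟨s - x (Fin.castAdd m (Fin.castAdd h k)) * t + t ^ 2, by linear_combination 2 * hs⟩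
  · obtain ⟨t, ht⟩ := h2
    exact ⟨t, by rw [ht]; ring⟩
  · obtain ⟨t, ht⟩ := h3 j
    exact ⟨t ^ 2, by rw [ht]; ring⟩

/-- The vector `(1, 0, 1)` with blocks of lengths `h`, `h`, `m`. -/
noncomputable def pairedHole (h m : ℕ) : EuclideanSpace ℝ (Fin (h + h + m)) :=
  WithLp.toLp 2 (Fin.append (Fin.append (fun _ => 1) (fun _ => 0)) (fun _ => 1))

/-- For `a ≡ b` mod 2, `1 - a` and `b` have opposite parity, so each pair contributes at least 1; so
does each even entry, compared with 1. -/
theorem le_sum_sq_pairedHole_sub {x : Fin (h + h + m) → ℤ}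
    (hx : modVector (h + h + m) 2 x ∈ (pairedParity h m).ker) :
    ((h + m : ℕ) : ℝ) ≤ ∑ i, (pairedHole h m i - x i) ^ 2 := by
  obtain ⟨h1, -, h3⟩ := modVector_mem_ker_pairedParity hx
  have hodd : ∀ z : ℤ, z ≠ 0 → 1 ≤ z ^ 2 := fun z hz => by
    have : 0 < z ^ 2 := by positivity
    lia
  rw [Fin.sum_univ_add, Fin.sum_univ_add, ← Finset.sum_add_distrib, Nat.cast_add]
  refine add_le_add ?_ ?_
  · have : ∀ k ∈ (Finset.univ : Finset (Fin h)), (1 : ℝ) ≤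
        (pairedHole h m (Fin.castAdd m (Fin.castAdd h k)) -
          x (Fin.castAdd m (Fin.castAdd h k))) ^ 2 +
        (pairedHole h m (Fin.castAdd m (Fin.natAdd h k)) -
          x (Fin.castAdd m (Fin.natAdd h k))) ^ 2 := fun k _ => by
      simp only [pairedHole, Fin.append_left, Fin.append_right]
      obtain ⟨t, ht⟩ := h1 k
      generalize x (Fin.castAdd m (Fin.castAdd h k)) = a at *
      generalize x (Fin.castAdd m (Fin.natAdd h k)) = b at *
      have : (1 : ℤ) ≤ (1 - a) ^ 2 + (0 - b) ^ 2 := by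
        by_cases hb : b = 0
        · have := hodd (1 - a) (by lia)
          nlinarith [sq_nonneg (0 - b)]
        · have := hodd (0 - b) (by lia)
          nlinarith [sq_nonneg (1 - a)]
      exact_mod_cast this
    have h := Finset.card_nsmul_le_sum _ _ _ this
    simpa using h
  · have : ∀ j ∈ (Finset.univ : Finset (Fin m)), (1 : ℝ) ≤
        (pairedHole h m (Fin.natAdd (h + h) j) - x (Fin.natAdd (h + h) j)) ^ 2 := fun j _ => by
      simp only [pairedHole, Fin.append_right]
      obtain ⟨t, ht⟩ := h3 j
      have := hodd (1 - x (Fin.natAdd (h + h) j)) (by lia)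
      exact_mod_cast this
    have h := Finset.card_nsmul_le_sum _ _ _ this
    simpa using h

theorem two_rpow_mul_sqrt_le_woodsN (hd : 1 ≤ h + h + m) :
    ((2 : ℝ) ^ (h + 1 + m)) ^ (-(1 / (h + h + m : ℕ) : ℝ)) * √((h + m : ℕ) : ℝ) ≤
      woodsN (h + h + m) := by
  refine le_trans ?_ (index_rpow_mul_le_woodsN hd (pairedParity h m).ker
    (fun x hx0 hx => four_le_sum_sq_of_mem_ker_pairedParity hx0 hx) (pairedHole h m)
    (fun x hx => le_sum_sq_pairedHole_sub hx))
  refine mul_le_mul_of_nonneg_right ?_ (Real.sqrt_nonneg _)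
  refine Real.rpow_le_rpow_of_nonpos ?_ ?_ ?_
  · exact Nat.cast_pos.2 (Nat.pos_of_ne_zero AddSubgroup.index_ne_zero_of_finite)
  · exact_mod_cast index_ker_pairedParity_le
  · exact neg_nonpos.2 (by positivity)

theorem sqrt_div_two_lt_woodsN {d : ℕ} (hd : 30 ≤ d) : √(d : ℝ) / 2 < woodsN d := by
  -- `h` is `d/4` rounded up and `r` is the rounding excess `4h - d`.
  obtain ⟨h, m, r, hr, hh, rfl⟩ : ∃ h m r : ℕ, r < 4 ∧ 4 * h = d + r ∧ d = h + h + m :=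
    ⟨(d + 3) / 4, d - 2 * ((d + 3) / 4), 4 * ((d + 3) / 4) - d, by lia, by lia, by lia⟩
  refine lt_of_lt_of_le ?_ (two_rpow_mul_sqrt_le_woodsN (by lia))
  set D : ℝ := ((h + h + m : ℕ) : ℝ) with hD
  have hD30 : (30 : ℝ) ≤ D := by
    rw [hD]
    exact_mod_cast hd
  have hhD : (4 : ℝ) * h = D + r := by
    rw [hD]
    exact_mod_cast hh
  have hhm : ((h + m : ℕ) : ℝ) = D - h := by
    rw [hD]
    push_cast
    ring
  have hr0 : (0 : ℝ) ≤ r := Nat.cast_nonneg r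
  have hr3 : (r : ℝ) ≤ 3 := by exact_mod_cast (by lia : r ≤ 3)
  have hpow : ((2 : ℝ) ^ (h + 1 + m)) ^ (-(1 / D)) = 2 ^ (((h : ℝ) - 1) / D) / 2 := by
    rw [← Real.rpow_natCast, ← Real.rpow_mul zero_le_two, ← Real.rpow_sub_one two_ne_zero]
    congr 1
    have : ((h + 1 + m : ℕ) : ℝ) = D - h + 1 := by
      rw [hD]
      push_cast
      ring
    rw [this]
    field_simp
    ring
  -- The left side is the value at `D = 30`; the quotient `1/4 - (4 - r)/(4D)` increases with `D`
  -- because `r < 4`.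
  have hexp : (26 + r : ℝ) / 120 ≤ ((h : ℝ) - 1) / D := by
    rw [div_le_div_iff₀ (by norm_num) (by linarith)]
    nlinarith
  have hv : (2 : ℝ) ^ ((26 + r : ℝ) / 120) ≤ 2 ^ (((h : ℝ) - 1) / D) :=
    Real.rpow_le_rpow_of_exponent_le one_le_two hexp
  set v : ℝ := (2 : ℝ) ^ ((26 + r : ℝ) / 120) with hvdef
  have hvpos : 0 < v := by positivity
  have hv120 : v ^ 120 = 2 ^ (26 + r) := by
    rw [hvdef, ← Real.rpow_natCast, ← Real.rpow_mul zero_le_two, ← Real.rpow_natCast]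
    congr 1
    push_cast
    ring
  have hkey : 120 < v ^ 2 * (90 - r) := by
    -- The 120th power clears the fractional exponent, leaving four numerical inequalities.
    refine lt_of_pow_lt_pow_left₀ 120 (mul_nonneg (sq_nonneg v) (by linarith)) ?_
    rw [mul_pow, ← pow_mul, mul_comm 2 120, pow_mul, hv120]
    interval_cases r <;> norm_num
  rw [hpow, hhm, div_mul_eq_mul_div]
  refine div_lt_div_of_pos_right ?_ two_pos
  refine lt_of_lt_of_le ?_ (mul_le_mul_of_nonneg_right hv (Real.sqrt_nonneg _))
  rw [Real.sqrt_lt' (by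
    refine mul_pos hvpos (Real.sqrt_pos.2 ?_)
    linarith), mul_pow, Real.sq_sqrt (by linarith)]
  have h1 : D * (90 - r) / 120 ≤ D - h := by nlinarith
  have h2 : v ^ 2 * (D * (90 - r) / 120) ≤ v ^ 2 * (D - h) :=
    mul_le_mul_of_nonneg_left h1 (sq_nonneg v)
  nlinarith

end PairedCode

/-! ### Large subspaces avoiding a finite set. -/

section AvoidingSubspace

/-- In a finite vector space, every subspace `M` contains a subspace avoiding a prescribed set of
nonzero vectors whose index in `M` is not much larger than the size of that set. -/
theorem exists_submodule_avoiding {F V : Type*} [Field F] [Finite F] [AddCommGroup V] [Module F V]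
    [Finite V] (M : Submodule F V) (B : Finset V) (hB : 0 ∉ B) :
    ∃ C ≤ M, (∀ b ∈ B, b ∉ C) ∧ Nat.card M ≤ Nat.card C * (Nat.card F * (B.card + 1)) := by
  classical
  have hfin : Finite (Submodule F V) := Finite.of_injective _ SetLike.coe_injective
  obtain ⟨C, hC⟩ := (Set.toFinite {C : Submodule F V | C ≤ M ∧ ∀ b ∈ B, b ∉ C}).exists_maximal
    ⟨⊥, bot_le, fun b hb h => hB ((Submodule.mem_bot F).1 h ▸ hb)⟩
  refine ⟨C, hC.prop.1, hC.prop.2, ?_⟩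
  -- If `x ∉ C`, maximality puts some `b = c + a x` of `B` in `C + F x`, with `a ≠ 0` since `b ∉ C`;
  -- solve for `x`. The extra element 0 serves `x ∈ C`.
  have hcover : ∀ x : M, ∃ (c : C) (a : F) (b : (insert 0 B : Finset V)),
      (c : V) + a • (b : V) = x := by
    rintro ⟨x, hx⟩
    by_cases hxC : x ∈ C
    · exact ⟨⟨x, hxC⟩, 0, ⟨0, Finset.mem_insert_self _ _⟩, by simp⟩
    · have hnot : ¬ (C ⊔ Submodule.span F {x} ≤ M ∧ ∀ b ∈ B, b ∉ C ⊔ Submodule.span F {x}) :=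
        fun h => hxC (hC.le_of_ge h le_sup_left
          ((le_sup_right : _ ≤ C ⊔ _) (Submodule.mem_span_singleton_self x)))
      have hle : C ⊔ Submodule.span F {x} ≤ M :=
        sup_le hC.prop.1 ((Submodule.span_singleton_le_iff_mem _ _).2 hx)
      push Not at hnot
      obtain ⟨b, hb, hbC⟩ := hnot hle
      obtain ⟨c, hc, y, hy, rfl⟩ := Submodule.mem_sup.1 hbC
      obtain ⟨a, rfl⟩ := Submodule.mem_span_singleton.1 hy
      have ha : a ≠ 0 := by
        rintro rfl
        rw [zero_smul, add_zero] at hb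
        exact hC.prop.2 c hb hc
      refine ⟨⟨-(a⁻¹ • c), C.neg_mem (C.smul_mem _ hc)⟩, a⁻¹,
        ⟨_, Finset.mem_insert_of_mem hb⟩, ?_⟩
      simp only [smul_add, smul_smul, inv_mul_cancel₀ ha, one_smul]
      abel
  choose c a b hcab using hcover
  have hinj : Function.Injective fun x : M => ((c x, a x, b x) :
      C × F × (insert 0 B : Finset V)) := by
    intro x y hxy
    simp only [Prod.mk.injEq] at hxy
    ext
    rw [← hcab x, ← hcab y, hxy.1, hxy.2.1, hxy.2.2]
  refine (Nat.card_le_card_of_injective _ hinj).trans ?_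
  rw [Nat.card_prod, Nat.card_prod, Nat.card_eq_fintype_card (α := (insert 0 B : Finset V)),
    Fintype.card_coe]
  gcongr
  exact Finset.card_insert_le _ _

end AvoidingSubspace

/-! ### Counting short integer vectors. -/

section ShortVectors

theorem sum_Icc_half_pow_natAbs (q : ℕ) :
    ∑ k ∈ Finset.Icc (-q : ℤ) q, (1 / 2 : ℝ) ^ k.natAbs = 3 - 2 * (1 / 2) ^ q := by
  induction q with
  | zero => norm_num
  | succ q ih =>
    have : Finset.Icc (-(q + 1 : ℕ) : ℤ) (q + 1 : ℕ) =
        insert ((q + 1 : ℕ) : ℤ) (insert (-(q + 1 : ℕ) : ℤ) (Finset.Icc (-q : ℤ) q)) := by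
      ext k
      simp only [Finset.mem_insert, Finset.mem_Icc]
      lia
    rw [this, Finset.sum_insert, Finset.sum_insert, ih, Int.natAbs_neg, Int.natAbs_natCast, pow_succ]
    · ring
    · simp only [Finset.mem_Icc]
      lia
    · simp only [Finset.mem_insert, Finset.mem_Icc]
      lia

/-- The integer vectors of length `n` and norm less than `q`. -/
noncomputable def shortIntVectors (n q : ℕ) : Finset (Fin n → ℤ) :=
  (Fintype.piFinset fun _ => Finset.Icc (-q : ℤ) q).filter fun z => ∑ i, z i ^ 2 < (q : ℤ) ^ 2

theorem mem_shortIntVectors {n q : ℕ} {z : Fin n → ℤ} :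
    z ∈ shortIntVectors n q ↔ ∑ i, z i ^ 2 < (q : ℤ) ^ 2 := by
  simp only [shortIntVectors, Finset.mem_filter, Fintype.mem_piFinset, Finset.mem_Icc,
    and_iff_right_iff_imp]
  intro h i
  have hi : z i ^ 2 ≤ ∑ i, z i ^ 2 :=
    Finset.single_le_sum (f := fun i => z i ^ 2) (fun j _ => sq_nonneg _) (Finset.mem_univ i)
  exact abs_le.1 (abs_le_of_sq_le_sq (hi.trans h.le) (Nat.cast_nonneg q))

/-- Give `z` the weight `∏ 2^(-|zᵢ|)`. Short vectors weigh at least `2^(-q²)` because `|zᵢ| ≤ zᵢ²`,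
and the total weight over the box factors into one-dimensional sums below 3. -/
theorem card_shortIntVectors_le (n q : ℕ) :
    ((shortIntVectors n q).card : ℝ) ≤ 2 ^ q ^ 2 * 3 ^ n := by
  have h1 : ((shortIntVectors n q).card : ℝ) * (1 / 2) ^ q ^ 2 ≤ 3 ^ n := by
    calc ((shortIntVectors n q).card : ℝ) * (1 / 2) ^ q ^ 2
        = ∑ z ∈ shortIntVectors n q, (1 / 2 : ℝ) ^ q ^ 2 := by
          rw [Finset.sum_const, nsmul_eq_mul]
      _ ≤ ∑ z ∈ shortIntVectors n q, ∏ i, (1 / 2 : ℝ) ^ (z i).natAbs := by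
          refine Finset.sum_le_sum fun z hz => ?_
          rw [Finset.prod_pow_eq_pow_sum]
          refine pow_le_pow_of_le_one (by norm_num) (by norm_num) ?_
          have h := (mem_shortIntVectors.1 hz).le
          have h2 : ∑ i, (z i).natAbs ≤ ∑ i, (z i).natAbs ^ 2 :=
            Finset.sum_le_sum fun i _ => Nat.le_self_pow two_ne_zero _
          refine h2.trans ?_
          zify
          simpa using h
      _ ≤ ∑ z ∈ Fintype.piFinset fun _ : Fin n => Finset.Icc (-q : ℤ) q,
            ∏ i, (1 / 2 : ℝ) ^ (z i).natAbs :=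
          Finset.sum_le_sum_of_subset_of_nonneg (Finset.filter_subset _ _)
            fun z _ _ => Finset.prod_nonneg fun i _ => by positivity
      _ = (3 - 2 * (1 / 2) ^ q) ^ n := by
          rw [← Finset.prod_univ_sum (fun _ : Fin n => Finset.Icc (-q : ℤ) q)
            (fun _ k => (1 / 2 : ℝ) ^ k.natAbs), Finset.prod_const, sum_Icc_half_pow_natAbs,
            Finset.card_univ, Fintype.card_fin]
      _ ≤ 3 ^ n := by
          have hle : (1 / 2 : ℝ) ^ q ≤ 1 := pow_le_one₀ (by norm_num) (by norm_num)
          have hpos : (0 : ℝ) < (1 / 2) ^ q := by positivity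
          exact pow_le_pow_left₀ (by linarith) (by linarith) n
  rw [one_div, inv_pow, ← div_eq_mul_inv, div_le_iff₀ (by positivity)] at h1
  linarith

theorem eq_zero_of_dvd_of_sq_lt {q : ℕ} {z : ℤ} (hdvd : (q : ℤ) ∣ z) (h : z ^ 2 < (q : ℤ) ^ 2) :
    z = 0 :=
  Int.eq_zero_of_abs_lt_dvd hdvd (by
    have := sq_lt_sq.1 h
    rwa [Nat.abs_cast] at this)

end ShortVectors

/-! ### Codes of small index with vanishing coordinates. -/

section DenseCode

variable {n m q : ℕ}

/-- Among words vanishing on the last `m` coordinates, avoid the reductions of nonzero short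
vectors. A short vector reducing into the code has last entries divisible by `q`, hence zero, so
only vectors of length `n` matter. -/
theorem exists_dense_code [hq : Fact q.Prime] (n m : ℕ) :
    ∃ C : AddSubgroup (Fin (n + m) → ZMod q),
      (∀ y ∈ C, ∀ j, y (Fin.natAdd n j) = 0) ∧
      (∀ x : Fin (n + m) → ℤ, x ≠ 0 → modVector (n + m) q x ∈ C → (q : ℤ) ^ 2 ≤ ∑ i, x i ^ 2) ∧
      C.index ≤ q ^ (m + 1) * (shortIntVectors n q).card := by
  classical
  let emb : (Fin n → ℤ) → (Fin (n + m) → ZMod q) := fun z =>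
    modVector (n + m) q (Fin.append z 0)
  let B : Finset (Fin (n + m) → ZMod q) := ((shortIntVectors n q).erase 0).image emb
  have hlt : ∀ {k : ℕ} {x : Fin k → ℤ}, ∑ i, x i ^ 2 < (q : ℤ) ^ 2 → ∀ i, (q : ℤ) ∣ x i →
      x i = 0 := fun {k x} hx i hi =>
    eq_zero_of_dvd_of_sq_lt hi (lt_of_le_of_lt (Finset.single_le_sum (f := fun i => x i ^ 2)
      (fun j _ => sq_nonneg _) (Finset.mem_univ i)) hx)
  have hB0 : 0 ∉ B := by
    intro h
    obtain ⟨z, hz, hz0⟩ := Finset.mem_image.1 h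
    obtain ⟨hne, hz⟩ := Finset.mem_erase.1 hz
    refine hne (funext fun i => hlt (mem_shortIntVectors.1 hz) i ?_)
    have := congrFun hz0 (Fin.castAdd m i)
    simp only [emb, modVector_apply, Fin.append_left] at this
    exact (ZMod.intCast_zmod_eq_zero_iff_dvd _ q).1 this
  let π : (Fin (n + m) → ZMod q) →ₗ[ZMod q] (Fin m → ZMod q) :=
    LinearMap.funLeft (ZMod q) (ZMod q) (Fin.natAdd n)
  obtain ⟨C, hCM, hCB, hcard⟩ := exists_submodule_avoiding (LinearMap.ker π) B hB0
  have hsupp : ∀ y ∈ C, ∀ j, y (Fin.natAdd n j) = 0 := fun y hy j =>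
    congrFun (LinearMap.mem_ker.1 (hCM hy)) j
  refine ⟨C.toAddSubgroup, hsupp, fun x hx0 hx => ?_, ?_⟩
  · by_contra! hxq
    have hlast : ∀ j, x (Fin.natAdd n j) = 0 := fun j =>
      hlt hxq _ ((ZMod.intCast_zmod_eq_zero_iff_dvd _ q).1 (hsupp _ hx j))
    have hxz : Fin.append (fun i => x (Fin.castAdd m i)) 0 = x := by
      funext i
      refine Fin.addCases (fun i => ?_) (fun j => ?_) i
      · rw [Fin.append_left]
      · rw [Fin.append_right, hlast]
        rfl
    refine hCB (modVector (n + m) q x) (Finset.mem_image.2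
      ⟨fun i => x (Fin.castAdd m i), Finset.mem_erase.2 ⟨fun h => hx0 ?_, ?_⟩, ?_⟩) hx
    · rw [← hxz, h]
      funext i
      refine Fin.addCases (fun i => ?_) (fun j => ?_) i <;> simp
    · rw [mem_shortIntVectors]
      rw [Fin.sum_univ_add] at hxq
      refine lt_of_le_of_lt ?_ hxq
      exact le_add_of_nonneg_right (Finset.sum_nonneg fun j _ => sq_nonneg _)
    · simp only [emb, hxz]
  · have hzero : (0 : Fin n → ℤ) ∈ shortIntVectors n q := by
      rw [mem_shortIntVectors]
      have := hq.out.pos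
      simp only [Pi.zero_apply, ne_eq, OfNat.ofNat_ne_zero, not_false_eq_true, zero_pow,
        Finset.sum_const_zero]
      positivity
    -- The zero vector is counted as short but not put in `B`, which absorbs the `+ 1`.
    have hBcard : B.card + 1 ≤ (shortIntVectors n q).card := by
      have h1 : B.card ≤ ((shortIntVectors n q).erase 0).card := Finset.card_image_le
      have h2 := Finset.card_erase_add_one hzero
      lia
    have hM : (LinearMap.ker π).toAddSubgroup.index ≤ q ^ m := by
      have : (LinearMap.ker π).toAddSubgroup = π.toAddMonoidHom.ker := rfl
      rw [this, AddSubgroup.index_ker]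
      refine (Nat.card_le_card_of_injective _ Subtype.val_injective).trans (le_of_eq ?_)
      simp [Nat.card_eq_fintype_card, ZMod.card]
    have hC1 := AddSubgroup.card_mul_index C.toAddSubgroup
    have hM1 := AddSubgroup.card_mul_index (LinearMap.ker π).toAddSubgroup
    have hpos : 0 < Nat.card C := Nat.card_pos
    rw [Nat.card_zmod] at hcard
    refine Nat.le_of_mul_le_mul_left ?_ hpos
    calc Nat.card C * C.toAddSubgroup.index
        = Nat.card (LinearMap.ker π) * (LinearMap.ker π).toAddSubgroup.index := hC1.trans hM1.symm
      _ ≤ (Nat.card C * (q * (B.card + 1))) * q ^ m := Nat.mul_le_mul hcard hM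
      _ ≤ (Nat.card C * (q * (shortIntVectors n q).card)) * q ^ m := by gcongr
      _ = Nat.card C * (q ^ (m + 1) * (shortIntVectors n q).card) := by ring

theorem rpow_mul_sqrt_le_woodsN_of_prime (hq : q.Prime) (hd : 1 ≤ n + m) :
    ((q : ℝ) ^ (m + 1) * (2 ^ q ^ 2 * 3 ^ n)) ^ (-(1 / (n + m : ℕ) : ℝ)) *
      √(m * ((q : ℝ) ^ 2 / 4)) ≤ woodsN (n + m) := by
  have : Fact q.Prime := ⟨hq⟩
  obtain ⟨C, hsupp, hmin, hidx⟩ := exists_dense_code (q := q) n m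
  refine le_trans ?_ (index_rpow_mul_le_woodsN (R := m * ((q : ℝ) ^ 2 / 4)) hd C hmin
    (WithLp.toLp 2 (Fin.append (fun _ => 0) fun _ => (q : ℝ) / 2)) fun x hx => ?_)
  · refine mul_le_mul_of_nonneg_right ?_ (Real.sqrt_nonneg _)
    refine Real.rpow_le_rpow_of_nonpos ?_ ?_ (neg_nonpos.2 (by positivity))
    · exact Nat.cast_pos.2 (Nat.pos_of_ne_zero AddSubgroup.index_ne_zero_of_finite)
    · refine le_trans (Nat.cast_le.2 hidx) ?_
      push_cast
      exact mul_le_mul_of_nonneg_left (card_shortIntVectors_le n q) (by positivity)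
  · rw [Fin.sum_univ_add]
    refine le_add_of_nonneg_of_le (Finset.sum_nonneg fun i _ => sq_nonneg _) ?_
    have : ∀ j ∈ (Finset.univ : Finset (Fin m)), (q : ℝ) ^ 2 / 4 ≤
        (Fin.append (fun _ : Fin n => (0 : ℝ)) (fun _ => (q : ℝ) / 2) (Fin.natAdd n j) -
          x (Fin.natAdd n j)) ^ 2 := fun j _ => by
      rw [Fin.append_right]
      obtain ⟨t, ht⟩ := (ZMod.intCast_zmod_eq_zero_iff_dvd _ q).1 (hsupp _ hx j)
      -- A multiple `q t` satisfies `(q/2 - q t)² = q²/4 + q² t (t - 1)`.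
      have h1 : (0 : ℤ) ≤ t * (t - 1) := by
        rcases le_or_gt t 0 with h | h
        · nlinarith
        · nlinarith
      have h2 : (0 : ℝ) ≤ t * (t - 1) := by exact_mod_cast h1
      rw [ht]
      push_cast
      nlinarith [mul_nonneg (sq_nonneg (q : ℝ)) h2]
    have h := Finset.card_nsmul_le_sum _ _ _ this
    simpa using h

end DenseCode

/-! ### Choice of parameters for the `d / √log d` bound. -/

section LowerBound

theorem div_sqrt_log_le_woodsN {d : ℕ} (hd : 16 ≤ d) :
    (1 / 144 : ℝ) * ((d : ℝ) / √(Real.log d)) ≤ woodsN d := by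
  have hd16 : (16 : ℝ) ≤ d := by exact_mod_cast hd
  set D : ℝ := (d : ℝ) with hD
  set ℓ := Real.log D with hℓ
  have hℓ2 : 2 ≤ ℓ := by
    rw [hℓ, Real.le_log_iff_exp_le (by linarith)]
    have h1 : Real.exp 2 = Real.exp 1 ^ 2 := by
      rw [← Real.exp_nat_mul]
      norm_num
    rw [h1]
    nlinarith [Real.exp_one_lt_d9, Real.exp_pos 1]
  have hℓd : ℓ ≤ D / 2 := by
    have h1 := Real.log_le_sub_one_of_pos (show (0 : ℝ) < D / 2 by linarith)
    rw [Real.log_div (by linarith) two_ne_zero] at h1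
    linarith [Real.log_two_lt_d9]
  have hℓ0 : 0 < ℓ := by linarith
  -- The bounds `2 ≤ ℓ ≤ D/2` give `m ≤ D/2`, so `n ≥ D/2`, and `D/ℓ ≥ 2`, so the floor costs at
  -- most a factor 2.
  obtain ⟨m, hm⟩ : ∃ m, m = ⌊D / ℓ⌋₊ := ⟨_, rfl⟩
  have hm1 : (m : ℝ) ≤ D / ℓ := hm ▸ Nat.floor_le (by positivity)
  have hm2 : D / ℓ < m + 1 := hm ▸ Nat.lt_floor_add_one _
  have hdℓ : D / ℓ ≤ D / 2 := div_le_div_of_nonneg_left (by linarith) two_pos hℓ2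
  have hdℓ2 : 2 ≤ D / ℓ := by
    rw [le_div_iff₀ hℓ0]
    linarith
  have hmd : m ≤ d := by
    have : (m : ℝ) ≤ D := by linarith
    exact Nat.cast_le.1 (hD ▸ this)
  obtain ⟨n, rfl⟩ : ∃ n, d = n + m := ⟨d - m, by lia⟩
  have hn : D / 2 ≤ n := by
    have : D = n + m := by
      rw [hD]
      push_cast
      ring
    linarith
  have hn8 : 8 ≤ n := by
    have : (8 : ℝ) ≤ n := by linarith
    exact_mod_cast this
  have hs2 : 2 ≤ Nat.sqrt n := Nat.le_sqrt'.2 (by lia)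
  -- Bertrand's postulate gives `√n / 2 < q ≤ √n`.
  obtain ⟨q, hq, hkq, hq2k⟩ := Nat.exists_prime_lt_and_le_two_mul (Nat.sqrt n / 2) (by lia)
  have hqn : q ^ 2 ≤ n := Nat.le_sqrt'.1 (by lia)
  have hnq : n < (2 * q) ^ 2 := Nat.sqrt_lt'.1 (by lia)
  have hq1 : (1 : ℝ) ≤ q := by exact_mod_cast hq.one_lt.le
  refine le_trans ?_ (rpow_mul_sqrt_le_woodsN_of_prime hq (n := n) (m := m) (by lia))
  rw [← hD]
  have hqD : (q : ℝ) ^ 2 ≤ D := by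
    rw [hD]
    exact_mod_cast hqn.trans (Nat.le_add_right n m)
  have hlogq : Real.log q ≤ ℓ / 2 := by
    have h1 := Real.log_le_log (by positivity) hqD
    rw [Real.log_pow] at h1
    push_cast at h1
    linarith
  -- `(m + 1) log q ≤ (D/ℓ + 1) ℓ/2 ≤ D`, and `e < 3`; this is why `m` is of order `D/ℓ`.
  have hqpow : (q : ℝ) ^ (m + 1) ≤ 3 ^ (n + m) := by
    have h1 : (q : ℝ) ^ (m + 1) = Real.exp ((m + 1 : ℕ) * Real.log q) := by
      rw [Real.exp_nat_mul, Real.exp_log (by linarith)]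
    have h2 : ((m + 1 : ℕ) : ℝ) * Real.log q ≤ ((n + m : ℕ) : ℝ) * 1 := by
      rw [← hD]
      push_cast
      have h3 : (m : ℝ) * ℓ ≤ D := (le_div_iff₀ hℓ0).1 hm1
      have h4 : ((m : ℝ) + 1) * Real.log q ≤ (m + 1) * (ℓ / 2) :=
        mul_le_mul_of_nonneg_left hlogq (by positivity)
      nlinarith
    rw [h1]
    refine (Real.exp_le_exp.2 h2).trans ?_
    rw [Real.exp_nat_mul]
    exact pow_le_pow_left₀ (Real.exp_pos _).le (by linarith [Real.exp_one_lt_d9]) _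
  have hidx : (q : ℝ) ^ (m + 1) * (2 ^ q ^ 2 * 3 ^ n) ≤ 18 ^ (n + m) := by
    have h1 : (2 : ℝ) ^ q ^ 2 ≤ 2 ^ (n + m) :=
      pow_le_pow_right₀ one_le_two (hqn.trans (Nat.le_add_right n m))
    have h2 : (3 : ℝ) ^ n ≤ 3 ^ (n + m) :=
      pow_le_pow_right₀ (by norm_num) (Nat.le_add_right n m)
    calc (q : ℝ) ^ (m + 1) * (2 ^ q ^ 2 * 3 ^ n)
        ≤ 3 ^ (n + m) * (2 ^ (n + m) * 3 ^ (n + m)) := by gcongr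
      _ = 18 ^ (n + m) := by
        rw [← mul_pow, ← mul_pow]
        norm_num
  have hscale : (1 / 18 : ℝ) ≤
      ((q : ℝ) ^ (m + 1) * (2 ^ q ^ 2 * 3 ^ n)) ^ (-(1 / D)) := by
    have h1 : ((18 : ℝ) ^ (n + m)) ^ (-(1 / D)) = 1 / 18 := by
      rw [← Real.rpow_natCast, ← Real.rpow_mul (by norm_num), ← hD, mul_neg,
        mul_one_div_cancel (by linarith), Real.rpow_neg_one]
      norm_num
    rw [← h1]
    exact Real.rpow_le_rpow_of_nonpos (by positivity) hidx (neg_nonpos.2 (by positivity))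
  have hrad : 1 / 8 * (D / √ℓ) ≤ √(m * ((q : ℝ) ^ 2 / 4)) := by
    refine Real.le_sqrt_of_sq_le ?_
    rw [mul_pow, div_pow D, Real.sq_sqrt hℓ0.le]
    have h1 : D / (2 * ℓ) ≤ m := by
      have : D / (2 * ℓ) = D / ℓ / 2 := by
        field_simp
      rw [this]
      linarith
    have h2 : D / 8 ≤ (q : ℝ) ^ 2 := by
      have : (n : ℝ) < (2 * q) ^ 2 := by exact_mod_cast hnq
      nlinarith
    calc (1 / 8) ^ 2 * (D ^ 2 / ℓ) = D / (2 * ℓ) * (D / 8 / 4) := by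
          field_simp
          norm_num
      _ ≤ m * ((q : ℝ) ^ 2 / 4) := by gcongr
  calc 1 / 144 * (D / √ℓ) = 1 / 18 * (1 / 8 * (D / √ℓ)) := by ring
    _ ≤ _ := mul_le_mul hscale hrad (by positivity) (by positivity)

theorem lt_woodsN_of_two_le {d : ℕ} (hd : 2 ≤ d) :
    (1 / 150 : ℝ) * ((d : ℝ) / √(Real.log d)) < woodsN d := by
  have hd2 : (2 : ℝ) ≤ d := by exact_mod_cast hd
  have hlog : 1 / 2 < Real.log d :=
    lt_of_lt_of_le (by linarith [Real.log_two_gt_d9]) (Real.log_le_log two_pos hd2)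
  have hs : 0 < √(Real.log d) := Real.sqrt_pos.2 (by linarith)
  rcases le_or_gt 16 d with h | h
  · refine lt_of_lt_of_le ?_ (div_sqrt_log_le_woodsN h)
    exact mul_lt_mul_of_pos_right (by norm_num) (by positivity)
  -- For `d < 16` the lattice `ℤ^d` already suffices.
  · have h16 : (d : ℝ) < 16 := by exact_mod_cast h
    refine lt_of_lt_of_le ?_ (coveringRadius_le_woodsN (by lia)
      (isWellRoundedUnimodular_intLattice (d := d)))
    rw [coveringRadius_intLattice, ← mul_div_assoc, div_lt_iff₀ hs]
    have h1 : 1 / 2 ≤ √(Real.log d) := Real.le_sqrt_of_sq_le (by linarith)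
    have h2 : √(d : ℝ) < 4 := (Real.sqrt_lt' (by norm_num)).2 (by linarith)
    have h3 : √(d : ℝ) * √(d : ℝ) = d := Real.mul_self_sqrt (by linarith)
    have h4 : 0 < √(d : ℝ) := Real.sqrt_pos.2 (by linarith)
    nlinarith

end LowerBound

theorem mainTheorem1 :
    (∀ d : ℕ, 1 ≤ d → IsGreatest (woodsRadii d) (woodsN d)) ∧
    (∃ c : ℝ, 0 < c ∧ ∀ d : ℕ, 2 ≤ d → woodsN d > c * ((d : ℝ) / √(Real.log (d : ℝ)))) ∧
    (∀ d : ℕ, 30 ≤ d → woodsN d > √(d : ℝ) / 2) ∧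
    (∀ d : ℕ, 30 ≤ d → IsWellRoundedUnimodular (intLattice d) ∧
      coveringRadius (intLattice d) = √(d : ℝ) / 2 ∧
      coveringRadius (intLattice d) < woodsN d) ∧
    ¬ WoodsConjecture := by
  refine ⟨fun d hd => isGreatest_woodsN hd, ⟨1 / 150, by norm_num, fun d hd =>
    lt_woodsN_of_two_le hd⟩, fun d hd => sqrt_div_two_lt_woodsN hd, fun d hd =>
    ⟨isWellRoundedUnimodular_intLattice, coveringRadius_intLattice, ?_⟩, fun h => ?_⟩
  · rw [coveringRadius_intLattice]
    exact sqrt_div_two_lt_woodsN hd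
  · exact (sqrt_div_two_lt_woodsN le_rfl).ne' (h 30 (by norm_num))
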